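/- For $n\ge 0$ and $q\in[0,1]$, let $\pi_{n,q}$ be the Mallows distribution, i.e. the probability measure on the symmetric group $\mathcal S_n$ with $\pi_{n,q}(\sigma)=q^{\mathrm{Inv}(\sigma)}/\sum_{\sigma'\in\mathcal S_n}q^{\mathrm{Inv}(\sigma')}$ (with $0^0=1$), where $\mathrm{Inv}(\sigma)=\#\{1\le i<j\le n:\sigma(i)>\sigma(j)\}$. Let $T_{n,q}$ be the binary search tree of the sequence $(\sigma(1),\dots,\sigma(n))$ for a $\pi_{n,q}$-distributed random permutation $\sigma$: the tree of the empty sequence is empty, and otherwise the first term is placed at the root, and the left (respectively right) subtree of the root is the binary search tree of the subsequence of the terms smaller (respectively larger) than the first term. Let $h(T)$ denote the greatest distance of a node of $T$ from the root (and $h(\emptyset)=0$). Let $(q_n)_{n\ge 0}$ be any $[0,1]$-valued sequence such that $n(1-q_n)/\log n\to\infty$ as $n\to\infty$. Then for every $\varepsilon>0$ and every $\lambda>0$, $$\mathbb P\left(\left|\frac{h(T_{n,q_n})}{n(1-q_n)}-1\right|>\varepsilon\right)=O\left(\frac1{n^{\lambda}}\right)\qquad\text{as }n\to\infty.$$ 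-/

import Mathlib

open Filter MeasureTheory Asymptotics
open scoped NNReal ENNReal

namespace MallowsTree

/-- A finite set of nodes of the complete infinite rooted binary tree. A node is a finite word over
`{0, 1}`, with `false` for `0` (a step to the left) and `true` for `1` (a step to the right);
the root is the empty word and the depth of a node is its length. -/
abbrev NodeSet : Type := Finset (List Bool)

/-- Every set of finite node sets is an event. -/
instance : MeasurableSpace NodeSet := ⊤

instance : DiscreteMeasurableSpace NodeSet := ⟨fun _ => trivial⟩

/-- The height: the largest depth of a node minus the smallest depth of a node
(and `0` for the empty tree). -/
noncomputable def height (T : NodeSet) : ℕ :=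
  T.sup List.length - sInf (List.length '' (T : Set (List Bool)))

/-- The binary search tree of a sequence of distinct elements. The tree of the empty sequence is
empty; otherwise the first term `a` sits at the root, the subsequence of the terms that are smaller
than `a` gives the left subtree and that of the terms larger than `a` gives the right subtree. -/
def bst {α : Type*} [LinearOrder α] : List α → NodeSet
  | [] => ∅
  | a :: l =>
    {[]} ∪ (bst (l.filter (fun b => b < a))).image (List.cons false)
      ∪ (bst (l.filter (fun b => a < b))).image (List.cons true)
termination_by l => l.length
decreasing_by
  all_goals
    simp only [List.length_cons]
    refine Nat.lt_succ_of_le ?_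
    rw [List.length_unattach]
    exact (List.length_filter_le _ _).trans (by simp)

/-- The number of inversions of a permutation. -/
def inv {n : ℕ} (σ : Equiv.Perm (Fin n)) : ℕ :=
  (Finset.univ.filter (fun p : Fin n × Fin n => p.1 < p.2 ∧ σ p.2 < σ p.1)).card

theorem inv_one (n : ℕ) : inv (1 : Equiv.Perm (Fin n)) = 0 := by
  rw [inv, Finset.card_eq_zero, Finset.filter_eq_empty_iff]
  rintro p - ⟨h, h'⟩
  exact lt_asymm h h'

theorem tsum_weight_ne_zero (n : ℕ) (q : ℝ≥0) :
    ∑' σ : Equiv.Perm (Fin n), (q : ℝ≥0∞) ^ inv σ ≠ 0 := by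
  intro h
  have h1 := ENNReal.tsum_eq_zero.1 h 1
  simp [inv_one] at h1

theorem tsum_weight_ne_top (n : ℕ) (q : ℝ≥0) :
    ∑' σ : Equiv.Perm (Fin n), (q : ℝ≥0∞) ^ inv σ ≠ ∞ := by
  rw [tsum_fintype]
  exact (ENNReal.sum_lt_top.2 fun σ _ => ENNReal.pow_lt_top ENNReal.coe_lt_top).ne

/-- The Mallows distribution `π_{n,q}` on the permutations of an `n`-element chain: the mass of `σ`
is `q ^ Inv(σ)` divided by the sum of these weights over all permutations (with `0 ^ 0 = 1`). -/
noncomputable def mallows (n : ℕ) (q : ℝ≥0) : PMF (Equiv.Perm (Fin n)) :=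
  PMF.normalize (fun σ => (q : ℝ≥0∞) ^ inv σ) (tsum_weight_ne_zero n q) (tsum_weight_ne_top n q)

/-- The law `MT(n,q)` of the Mallows tree `T_{n,q}`: the law of the binary search tree of the
sequence `σ(1), …, σ(n)` for a `π_{n,q}`-distributed random permutation `σ`. -/
noncomputable def mallowsTree (n : ℕ) (q : ℝ≥0) : PMF NodeSet :=
  (mallows n q).map (fun σ : Equiv.Perm (Fin n) => bst (List.ofFn σ))

end MallowsTree

/-! Write m = n(1-q) and [n] = 1 + q + ⋯ + q^(n-1). Both tails follow from Markov's inequality. The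
upper tail uses the mean f(n) of the sum of x^depth over all nodes, with x slightly above 1: this
sum is at least x^height. The lower tail uses the mean g(n) of y^(size of the right spine), with y <
1: the spine has at most height + 1 nodes.

The root has rank k with probability q^k/[n], and the two subtrees are Mallows trees of sizes k and
n-1-k (`wmean_filter`, `wmean_bst`). Both statistics are affine in the values on the two subtrees,
so their means satisfy linear recursions (`treeMean_rec`). Subtracting q times the recursion at one
size from that at the next leaves one-step relations.

For the spine the relation is a product formula with factors 1 - (1-y)/[j]; since 1/[j] ≥ 1-q, g(n)
≤ exp(-(1-y)m) (`spineMean_le`). For the depths the factor is 1 + (x-1)/[j] up to errors decaying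
geometrically in j, because left subtrees are small. Since 1/[j] ≤ (1-q) + 1/j, f(n) ≤ C n^8
exp((x-1)m), where C depends on x only (`treeMean_depthGen_le`).

Dividing by x^((1+ε)m) and y^((1-ε)m+1) leaves negative exponents linear in m, since log x ≈ x-1
near 1. As m/log n → ∞, these beat every power of n. -/

namespace MallowsTree

/-! ### Weighted sums over words, expanded by the first letter -/

section Words

variable {α : Type} [LinearOrder α]

/-- The number of inversions of a word. -/
def wordInv : List α → ℕ
  | [] => 0
  | a :: l => l.countP (fun b => b < a) + wordInv l

/-- The arrangements of a finite set into a word without repetitions. -/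
def arrangements (s : Finset α) : Finset (List α) := s.val.lists.toFinset

theorem mem_arrangements {s : Finset α} {l : List α} :
    l ∈ arrangements s ↔ s.val = (l : Multiset α) := by
  rw [arrangements, Multiset.mem_toFinset, Multiset.mem_lists_iff]
  rfl

/-- The sum of `F` over the arrangements of `s`, weighted by `q ^ inversions`. -/
noncomputable def wsum (q : ℝ) (s : Finset α) (F : List α → ℝ) : ℝ :=
  ∑ l ∈ arrangements s, q ^ wordInv l * F l

/-- The number of elements of `s` below `a`. -/
def rankIn (s : Finset α) (a : α) : ℕ := (s.filter (fun b => b < a)).card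

theorem wsum_empty (q : ℝ) (F : List α → ℝ) : wsum q ∅ F = F [] := by
  have h : arrangements (∅ : Finset α) = {[]} := by
    ext l
    simp [mem_arrangements, eq_comm]
  simp [wsum, h, wordInv]

theorem wsum_cons (q : ℝ) {s : Finset α} (hs : s.Nonempty) (F : List α → ℝ) :
    wsum q s F = ∑ a ∈ s, q ^ rankIn s a * wsum q (s.erase a) (fun l => F (a :: l)) := by
  have h : arrangements s = s.biUnion (fun a => (arrangements (s.erase a)).image (List.cons a)) := by
    ext l
    simp only [mem_arrangements, Finset.mem_biUnion, Finset.mem_image]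
    constructor
    · intro h
      cases l with
      | nil => simp at h; simp [h] at hs
      | cons a l =>
        have ha : a ∈ s := by rw [← Finset.mem_val, h]; simp
        refine ⟨a, ha, l, ?_, rfl⟩
        rw [Finset.erase_val, h, ← Multiset.cons_coe, Multiset.erase_cons_head]
    · rintro ⟨a, ha, l, h, rfl⟩
      rw [← Multiset.cons_coe, ← h, Finset.erase_val, Multiset.cons_erase ha]
  unfold wsum
  rw [h, Finset.sum_biUnion]
  · refine Finset.sum_congr rfl fun a ha => ?_
    rw [Finset.sum_image (fun _ _ _ _ h => (List.cons.inj h).2), Finset.mul_sum]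
    refine Finset.sum_congr rfl fun l hl => ?_
    rw [mem_arrangements] at hl
    have : l.countP (fun b => b < a) = rankIn s a := by
      rw [← Multiset.coe_countP, ← hl, Multiset.countP_eq_card_filter, rankIn,
        ← Finset.filter_val, Finset.card_val]
      congr 1
      ext b
      simp only [Finset.mem_filter, Finset.mem_erase]
      exact ⟨fun h => ⟨h.1.2, h.2⟩, fun h => ⟨⟨h.2.ne, h.1⟩, h.2⟩⟩
    rw [wordInv, this, pow_add, mul_assoc]
  · intro a _ b _ hab
    rw [Function.onFun, Finset.disjoint_left]
    intro l hl hl'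
    simp only [Finset.mem_image] at hl hl'
    obtain ⟨_, _, rfl⟩ := hl
    obtain ⟨_, _, h⟩ := hl'
    exact hab (List.cons.inj h).1.symm

theorem rankIn_lt {s : Finset α} {a : α} (ha : a ∈ s) : rankIn s a < s.card := by
  refine Finset.card_lt_card (Finset.filter_ssubset.2 ⟨a, ha, lt_irrefl a⟩)

theorem rankIn_strictMonoOn (s : Finset α) : StrictMonoOn (rankIn s) s := by
  intro a ha b _ hab
  refine Finset.card_lt_card ?_
  rw [Finset.ssubset_iff_of_subset]
  · exact ⟨a, by simpa using ⟨ha, hab⟩, by simp⟩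
  · exact Finset.monotone_filter_right _ fun c _ hc => lt_trans hc hab

theorem image_rankIn (s : Finset α) : s.image (rankIn s) = Finset.range s.card := by
  refine Finset.eq_of_subset_of_card_le ?_ ?_
  · intro k hk
    obtain ⟨a, ha, rfl⟩ := Finset.mem_image.1 hk
    exact Finset.mem_range.2 (rankIn_lt ha)
  · rw [Finset.card_range, Finset.card_image_of_injOn (rankIn_strictMonoOn s).injOn]

theorem sum_rankIn (s : Finset α) (g : ℕ → ℝ) :
    ∑ a ∈ s, g (rankIn s a) = ∑ k ∈ Finset.range s.card, g k := by
  rw [← image_rankIn, Finset.sum_image (rankIn_strictMonoOn s).injOn]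

theorem card_filter_gt {s : Finset α} {a : α} (ha : a ∈ s) :
    (s.filter (fun b => a < b)).card = s.card - 1 - rankIn s a := by
  have h1 := Finset.card_filter_add_card_filter_not (s := s.erase a) (fun b => b < a)
  rw [Finset.card_erase_of_mem ha] at h1
  have h2 : (s.erase a).filter (fun b => b < a) = s.filter (fun b => b < a) := by
    ext b; simp only [Finset.mem_filter, Finset.mem_erase]; grind
  have h3 : (s.erase a).filter (fun b => ¬ b < a) = s.filter (fun b => a < b) := by
    ext b; simp only [Finset.mem_filter, Finset.mem_erase]; grind
  rw [h2, h3] at h1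
  rw [rankIn]; omega

end Words

/-! ### q-numbers and q-factorials -/

/-- The `q`-analogue `1 + q + ⋯ + q ^ (n - 1)` of `n`. -/
noncomputable def qnum (q : ℝ) (n : ℕ) : ℝ := ∑ i ∈ Finset.range n, q ^ i

/-- The `q`-factorial. -/
noncomputable def qfact (q : ℝ) (n : ℕ) : ℝ := ∏ i ∈ Finset.range n, qnum q (i + 1)

theorem qnum_succ (q : ℝ) (n : ℕ) : qnum q (n + 1) = 1 + q * qnum q n := by
  rw [qnum, Finset.sum_range_succ', qnum, Finset.mul_sum, add_comm]
  simp [pow_succ']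

theorem qnum_nonneg {q : ℝ} (hq : 0 ≤ q) (n : ℕ) : 0 ≤ qnum q n :=
  Finset.sum_nonneg fun _ _ => pow_nonneg hq _

theorem qnum_succ_pos {q : ℝ} (hq : 0 ≤ q) (n : ℕ) : 0 < qnum q (n + 1) := by
  rw [qnum_succ]
  have := mul_nonneg hq (qnum_nonneg hq n)
  linarith

theorem qfact_succ (q : ℝ) (n : ℕ) : qfact q (n + 1) = qfact q n * qnum q (n + 1) :=
  Finset.prod_range_succ _ _

theorem qfact_pos {q : ℝ} (hq : 0 ≤ q) (n : ℕ) : 0 < qfact q n :=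
  Finset.prod_pos fun i _ => qnum_succ_pos hq i

/-! ### Mallows means and their restriction to segments -/

section Restriction

variable {α : Type} [LinearOrder α]

/-- The expectation of `F` over a Mallows-distributed arrangement of `s`. -/
noncomputable def wmean (q : ℝ) (s : Finset α) (F : List α → ℝ) : ℝ :=
  wsum q s F / qfact q s.card

theorem wmean_empty (q : ℝ) (F : List α → ℝ) : wmean q ∅ F = F [] := by
  simp [wmean, wsum_empty, qfact]

theorem wmean_cons (q : ℝ) {s : Finset α} (hs : s.Nonempty) (F : List α → ℝ) :
    wmean q s F = (∑ a ∈ s, q ^ rankIn s a * wmean q (s.erase a) (fun l => F (a :: l))) /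
      qnum q s.card := by
  obtain ⟨n, hn⟩ : ∃ n, s.card = n + 1 := Nat.exists_eq_succ_of_ne_zero hs.card_pos.ne'
  rw [wmean, wsum_cons q hs, hn, qfact_succ, ← div_div, Finset.sum_div]
  congr 1
  refine Finset.sum_congr rfl fun a ha => ?_
  rw [wmean, Finset.card_erase_of_mem ha, hn, Nat.add_sub_cancel, mul_div_assoc]

theorem wmean_add (q : ℝ) (s : Finset α) (F G : List α → ℝ) :
    wmean q s (fun l => F l + G l) = wmean q s F + wmean q s G := by
  simp only [wmean, wsum, mul_add, Finset.sum_add_distrib, add_div]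

theorem wmean_mul (q : ℝ) (s : Finset α) (c : ℝ) (F : List α → ℝ) :
    wmean q s (fun l => c * F l) = c * wmean q s F := by
  simp only [wmean, wsum, Finset.mul_sum, Finset.sum_div]
  refine Finset.sum_congr rfl fun _ _ => by ring

theorem wmean_mono {q : ℝ} (hq : 0 ≤ q) (s : Finset α) {F G : List α → ℝ}
    (h : ∀ l : List α, (l : Multiset α) = s.val → F l ≤ G l) : wmean q s F ≤ wmean q s G := by
  refine div_le_div_of_nonneg_right ?_ (qfact_pos hq _).le
  refine Finset.sum_le_sum fun l hl => ?_
  exact mul_le_mul_of_nonneg_left (h l (mem_arrangements.1 hl).symm) (pow_nonneg hq _)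

theorem wmean_const {q : ℝ} (hq : 0 ≤ q) (s : Finset α) (c : ℝ) :
    wmean q s (fun _ => c) = c := by
  induction s using Finset.strongInduction with
  | H s ih =>
    rcases s.eq_empty_or_nonempty with rfl | hs
    · rw [wmean_empty]
    · rw [wmean_cons q hs, Finset.sum_congr rfl fun a ha => by
        rw [ih _ (Finset.erase_ssubset ha)], ← Finset.sum_mul,
        sum_rankIn s (fun k => q ^ k), ← qnum, mul_comm, mul_div_assoc, div_self, mul_one]
      obtain ⟨n, hn⟩ : ∃ n, s.card = n + 1 := Nat.exists_eq_succ_of_ne_zero hs.card_pos.ne'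
      rw [hn]
      exact (qnum_succ_pos hq n).ne'

/-- The restriction of a Mallows-distributed arrangement to a segment whose elements have their
ranks shifted by a constant is Mallows-distributed. -/
theorem wmean_filter {q : ℝ} (hq : 0 ≤ q) (p : α → Prop) [DecidablePred p]
    (hp : ∀ s : Finset α, ∃ A : ℝ, ∀ a ∈ s, p a →
      q ^ rankIn s a = A * q ^ rankIn (s.filter p) a)
    (s : Finset α) (F : List α → ℝ) :
    wmean q s (fun l => F (l.filter p)) = wmean q (s.filter p) F := by
  induction s using Finset.strongInduction generalizing F with
  | H s ih =>
    rcases s.eq_empty_or_nonempty with rfl | hs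
    · simp [wmean_empty]
    obtain ⟨A, hA⟩ := hp s
    obtain ⟨n, hn⟩ : ∃ n, s.card = n + 1 := Nat.exists_eq_succ_of_ne_zero hs.card_pos.ne'
    have hpos : 0 < qnum q s.card := by rw [hn]; exact qnum_succ_pos hq n
    -- First letters satisfying `p` become the first letter of the filtered word; up to the factor
    -- `A` they carry the right Mallows weights, so the expansion of the restricted mean reappears.
    have hfirst : ∑ a ∈ s.filter p, q ^ rankIn s a *
        wmean q (s.erase a) (fun l => F ((a :: l).filter p)) =
        A * qnum q (s.filter p).card * wmean q (s.filter p) F := by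
      rcases (s.filter p).eq_empty_or_nonempty with he | hne
      · simp [he, qnum]
      · obtain ⟨m, hm⟩ : ∃ m, (s.filter p).card = m + 1 :=
          Nat.exists_eq_succ_of_ne_zero hne.card_pos.ne'
        have hm' : qnum q (s.filter p).card ≠ 0 := by rw [hm]; exact (qnum_succ_pos hq m).ne'
        rw [wmean_cons q hne, mul_assoc, mul_div_cancel₀ _ hm', Finset.mul_sum]
        refine Finset.sum_congr rfl fun a ha => ?_
        rw [Finset.mem_filter] at ha
        have h1 : ∀ l : List α, (a :: l).filter p = a :: l.filter p := fun l => by simp [ha.2]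
        simp only [h1]
        rw [ih _ (Finset.erase_ssubset ha.1) (fun l => F (a :: l)), hA a ha.1 ha.2,
          Finset.filter_erase, mul_assoc]
    -- A first letter failing `p` disappears under the filter and leaves `s.filter p` unchanged.
    have hsecond : ∑ a ∈ s.filter (fun a => ¬ p a), q ^ rankIn s a *
        wmean q (s.erase a) (fun l => F ((a :: l).filter p)) =
        (∑ a ∈ s.filter (fun a => ¬ p a), q ^ rankIn s a) * wmean q (s.filter p) F := by
      rw [Finset.sum_mul]
      refine Finset.sum_congr rfl fun a ha => ?_
      rw [Finset.mem_filter] at ha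
      have h1 : ∀ l : List α, (a :: l).filter p = l.filter p := fun l => by simp [ha.2]
      simp only [h1]
      rw [ih _ (Finset.erase_ssubset ha.1) F, Finset.filter_erase, Finset.erase_eq_of_notMem]
      simp [ha.2]
    have htotal : A * qnum q (s.filter p).card +
        ∑ a ∈ s.filter (fun a => ¬ p a), q ^ rankIn s a = qnum q s.card := by
      rw [qnum, ← sum_rankIn (s.filter p) (fun k => q ^ k), Finset.mul_sum, qnum,
        ← sum_rankIn s (fun k => q ^ k), ← Finset.sum_filter_add_sum_filter_not s p]
      congr 1
      refine Finset.sum_congr rfl fun a ha => ?_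
      rw [Finset.mem_filter] at ha
      exact (hA a ha.1 ha.2).symm
    rw [wmean_cons q hs, ← Finset.sum_filter_add_sum_filter_not s p, hfirst, hsecond, ← add_mul,
      htotal, mul_div_assoc, mul_div_cancel₀ _ hpos.ne']

theorem wmean_filter_lt {q : ℝ} (hq : 0 ≤ q) (c : α) (s : Finset α) (F : List α → ℝ) :
    wmean q s (fun l => F (l.filter (fun b => b < c))) =
      wmean q (s.filter (fun b => b < c)) F := by
  refine wmean_filter hq _ (fun s => ⟨1, fun a _ hac => ?_⟩) s F
  rw [one_mul, rankIn, rankIn, Finset.filter_filter]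
  congr 2
  ext b
  simp only [Finset.mem_filter]
  exact ⟨fun h => ⟨h.1, h.2.trans hac, h.2⟩, fun h => ⟨h.1, h.2.2⟩⟩

theorem wmean_filter_gt {q : ℝ} (hq : 0 ≤ q) (c : α) (s : Finset α) (F : List α → ℝ) :
    wmean q s (fun l => F (l.filter (fun b => c < b))) =
      wmean q (s.filter (fun b => c < b)) F := by
  refine wmean_filter hq _
    (fun s => ⟨q ^ (s.filter (fun b => ¬ c < b)).card, fun a _ hac => ?_⟩) s F
  rw [← pow_add, rankIn, rankIn,
    ← Finset.card_filter_add_card_filter_not (s := s.filter (fun b => b < a)) (fun b => c < b),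
    add_comm]
  congr 3
  · ext b
    simp only [Finset.mem_filter]
    exact ⟨fun h => ⟨h.1.1, h.2⟩, fun h => ⟨⟨h.1, (not_lt.1 h.2).trans_lt hac⟩, h.2⟩⟩
  · rw [Finset.filter_filter, Finset.filter_filter]
    simp only [and_comm]

end Restriction

/-! ### Recursion for means of affine tree statistics -/

section Trees

variable {α : Type} [LinearOrder α]

/-- The tree with left subtree `S` and right subtree `T`. -/
def node (S T : NodeSet) : NodeSet :=
  {[]} ∪ S.image (List.cons false) ∪ T.image (List.cons true)

theorem bst_nil : bst ([] : List α) = ∅ := by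
  rw [bst]

theorem bst_cons (a : α) (l : List α) :
    bst (a :: l) = node (bst (l.filter (fun b => b < a))) (bst (l.filter (fun b => a < b))) := by
  rw [bst, node]

/-- The expectation of `φ` over the Mallows tree of size `n`. -/
noncomputable def treeMean (q : ℝ) (φ : NodeSet → ℝ) (n : ℕ) : ℝ :=
  wmean q (Finset.range n) (fun l => φ (bst l))

/-- Because the statistic is affine in its values on the subtrees, only the marginal law of each
subtree given the root enters, and no independence is required. -/
theorem wmean_bst_cons {q : ℝ} (hq : 0 ≤ q) {φ : NodeSet → ℝ} {A B C : ℝ}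
    (hφ : ∀ S T, φ (node S T) = A + B * φ S + C * φ T) {s : Finset α} (hs : s.Nonempty) :
    wmean q s (fun l => φ (bst l)) = (∑ a ∈ s, q ^ rankIn s a *
      (A + B * wmean q (s.filter (fun b => b < a)) (fun l => φ (bst l)) +
        C * wmean q (s.filter (fun b => a < b)) (fun l => φ (bst l)))) / qnum q s.card := by
  rw [wmean_cons q hs]
  congr 1
  refine Finset.sum_congr rfl fun a ha => ?_
  simp only [bst_cons, hφ]
  rw [wmean_add, wmean_add, wmean_const hq, wmean_mul, wmean_mul,
    wmean_filter_lt hq a _ (fun l => φ (bst l)), wmean_filter_gt hq a _ (fun l => φ (bst l)),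
    Finset.filter_erase, Finset.filter_erase, Finset.erase_eq_of_notMem (by simp),
    Finset.erase_eq_of_notMem (by simp)]

/-- The law of the tree depends on the size of the set only. -/
theorem wmean_bst {q : ℝ} (hq : 0 ≤ q) {φ : NodeSet → ℝ} {A B C : ℝ}
    (hφ : ∀ S T, φ (node S T) = A + B * φ S + C * φ T) (n : ℕ) :
    ∀ {α : Type} [LinearOrder α] (s : Finset α), s.card = n →
      wmean q s (fun l => φ (bst l)) = treeMean q φ n := by
  induction n using Nat.strong_induction_on with
  | _ n ih =>
    -- The right-hand side mentions only `n`, so applying this to `s` and to `Finset.range n`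
    -- identifies the two means.
    have key : ∀ {α : Type} [LinearOrder α] (s : Finset α), s.card = n → s.Nonempty →
        wmean q s (fun l => φ (bst l)) = (∑ k ∈ Finset.range n, q ^ k *
          (A + B * treeMean q φ k + C * treeMean q φ (n - 1 - k))) / qnum q n := by
      intro α _ s hs hne
      rw [wmean_bst_cons hq hφ hne, hs, ← hs, ← sum_rankIn s, hs]
      congr 1
      refine Finset.sum_congr rfl fun a ha => ?_
      have h1 := rankIn_lt ha
      rw [ih (rankIn s a) (hs ▸ h1) (s.filter (fun b => b < a)) rfl,
        ih (n - 1 - rankIn s a) (by omega) (s.filter (fun b => a < b))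
          (by rw [card_filter_gt ha, hs])]
    intro α _ s hs
    rcases s.eq_empty_or_nonempty with rfl | hne
    · rw [Finset.card_empty] at hs
      subst hs
      rw [treeMean, Finset.range_zero, wmean_empty, wmean_empty, bst_nil, bst_nil]
    · rw [key s hs hne, treeMean, key (Finset.range n) (Finset.card_range n)
        (Finset.nonempty_range_iff.2 (hs ▸ hne.card_pos.ne'))]

theorem treeMean_zero (q : ℝ) (φ : NodeSet → ℝ) : treeMean q φ 0 = φ ∅ := by
  rw [treeMean, Finset.range_zero, wmean_empty, bst_nil]

theorem treeMean_rec {q : ℝ} (hq : 0 ≤ q) {φ : NodeSet → ℝ} {A B C : ℝ}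
    (hφ : ∀ S T, φ (node S T) = A + B * φ S + C * φ T) (n : ℕ) :
    treeMean q φ n * qnum q n = A * qnum q n + B * (∑ k ∈ Finset.range n, q ^ k * treeMean q φ k) +
      C * (∑ k ∈ Finset.range n, q ^ k * treeMean q φ (n - 1 - k)) := by
  rcases Nat.eq_zero_or_pos n with rfl | hn
  · simp [qnum]
  have hpos : 0 < qnum q n := by
    obtain ⟨m, rfl⟩ := Nat.exists_eq_succ_of_ne_zero hn.ne'
    exact qnum_succ_pos hq m
  have h := wmean_bst_cons hq hφ (Finset.nonempty_range_iff.2 hn.ne')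
  rw [← treeMean, Finset.card_range, eq_div_iff hpos.ne'] at h
  have hs := sum_rankIn (Finset.range n) (fun k => q ^ k *
    (A + B * treeMean q φ k + C * treeMean q φ (n - 1 - k)))
  rw [Finset.card_range] at hs
  have h2 : treeMean q φ n * qnum q n = ∑ k ∈ Finset.range n, q ^ k *
      (A + B * treeMean q φ k + C * treeMean q φ (n - 1 - k)) := by
    rw [h, ← hs]
    refine Finset.sum_congr rfl fun a ha => ?_
    rw [wmean_bst hq hφ (rankIn (Finset.range n) a) _ rfl,
      wmean_bst hq hφ (n - 1 - rankIn (Finset.range n) a) _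
        (by rw [card_filter_gt ha, Finset.card_range])]
  rw [h2, qnum, Finset.mul_sum, Finset.mul_sum, Finset.mul_sum, ← Finset.sum_add_distrib,
    ← Finset.sum_add_distrib]
  exact Finset.sum_congr rfl fun _ _ => by ring

end Trees

/-! ### Elementary estimates and the choice of rates -/

/-- The right-hand sides telescope, so errors of order 1/n in the exponent cost only a power of n.
-/
theorem exp_inv_succ_le {n : ℕ} (hn : 1 ≤ n) :
    Real.exp (1 / ((n : ℝ) + 1)) ≤ ((n : ℝ) + 1) / n := by
  have hn' : (1 : ℝ) ≤ n := by exact_mod_cast hn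
  have h1 : (n : ℝ) / (n + 1) ≤ Real.exp (-(1 / ((n : ℝ) + 1))) := by
    have := Real.add_one_le_exp (-(1 / ((n : ℝ) + 1)))
    have h2 : (n : ℝ) / (n + 1) = -(1 / ((n : ℝ) + 1)) + 1 := by field_simp; ring
    rwa [h2]
  rw [Real.exp_neg] at h1
  have h3 : 0 < (n : ℝ) / (n + 1) := by positivity
  have h4 := inv_anti₀ h3 h1
  rwa [inv_inv, inv_div] at h4

theorem geom_decay_sum (r : ℝ) (hr : 1 ≤ r) (n : ℕ) :
    (r - 1) * ∑ j ∈ Finset.range n, (r ^ j)⁻¹ ≤ r := by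
  have h0 : r ≠ 0 := by linarith
  have h : (r - 1) * ∑ j ∈ Finset.range n, (r ^ j)⁻¹ = r - r * (r ^ n)⁻¹ := by
    induction n with
    | zero => simp
    | succ n ih =>
      rw [Finset.sum_range_succ, mul_add, ih, pow_succ]
      field_simp
      ring
  rw [h]
  have : 0 ≤ r * (r ^ n)⁻¹ := by positivity
  linarith

/-- The last quantity is the decay rate in the upper-tail Markov bound. By log x ≥ 1 - 1/x it is at
least (x-1)(1+ε-x)/x, which is positive for 1 < x < 1+ε. The cap 3/2 keeps the left-subtree terms
under control later. -/
theorem exists_upper_rate {ε : ℝ} (hε : 0 < ε) :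
    ∃ x : ℝ, 1 < x ∧ x ≤ 3 / 2 ∧ 0 < (1 + ε) * Real.log x - (x - 1) := by
  refine ⟨min (3 / 2) (1 + ε / 2), lt_min (by norm_num) (by linarith), min_le_left _ _, ?_⟩
  set x := min (3 / 2) (1 + ε / 2) with hx
  have h1 : 1 < x := by rw [hx, lt_min_iff]; constructor <;> linarith
  have h2 : x ≤ 1 + ε / 2 := min_le_right _ _
  have h3 := Real.one_sub_inv_le_log_of_pos (show 0 < x by linarith)
  have h4 : (1 + ε) * (1 - x⁻¹) - (x - 1) = (x - 1) * ((1 + ε - x) / x) := by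
    field_simp
  have h5 : 0 < (x - 1) * ((1 + ε - x) / x) :=
    mul_pos (by linarith) (div_pos (by linarith) (by linarith))
  have h6 := mul_le_mul_of_nonneg_left h3 (show 0 ≤ 1 + ε by linarith)
  linarith

theorem exists_lower_rate {ε : ℝ} (hε : 0 < ε) :
    ∃ y : ℝ, 0 < y ∧ y < 1 ∧ 0 < (1 - y) + (1 - ε) * Real.log y := by
  rcases lt_or_ge ε 1 with h | h
  · refine ⟨1 - ε / 2, by linarith, by linarith, ?_⟩
    set y := 1 - ε / 2 with hy
    have h0 : 0 < y := by linarith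
    have h3 := Real.one_sub_inv_le_log_of_pos h0
    have h6 := mul_le_mul_of_nonneg_left h3 (show 0 ≤ 1 - ε by linarith)
    have h4 : (1 - y) + (1 - ε) * (1 - y⁻¹) = (1 - y) * ((y - (1 - ε)) / y) := by
      field_simp; ring
    have h5 : 0 < (1 - y) * ((y - (1 - ε)) / y) :=
      mul_pos (by linarith) (div_pos (by linarith) h0)
    linarith
  -- For ε ≥ 1 the logarithmic term is nonnegative, so any y in (0, 1) works.
  · refine ⟨1 / 2, by norm_num, by norm_num, ?_⟩
    have h1 : Real.log (1 / 2) ≤ 0 := Real.log_nonpos (by norm_num) (by norm_num)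
    have := mul_nonneg_of_nonpos_of_nonpos (show 1 - ε ≤ 0 by linarith) h1
    linarith

/-- An exponential decay in a quantity beating the logarithm beats every power. -/
theorem pow_mul_exp_isBigO {m : ℕ → ℝ}
    (hm : Filter.Tendsto (fun n : ℕ => m n / Real.log n) Filter.atTop Filter.atTop)
    {c : ℝ} (hc : 0 < c) (D : ℕ) (lam : ℝ) :
    (fun n : ℕ => (n : ℝ) ^ D * Real.exp (-(c * m n))) =O[Filter.atTop]
      (fun n : ℕ => 1 / (n : ℝ) ^ lam) := by
  refine Asymptotics.IsBigO.of_bound 1 ?_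
  filter_upwards [hm.eventually_ge_atTop ((lam + D) / c), Filter.eventually_ge_atTop 2]
    with n hn hn2
  have hn2' : (2 : ℝ) ≤ n := by exact_mod_cast hn2
  have hn0 : (0 : ℝ) < n := by linarith
  have hlog : 0 < Real.log n := Real.log_pos (by linarith)
  rw [le_div_iff₀ hlog, div_mul_eq_mul_div, div_le_iff₀ hc] at hn
  rw [Real.norm_of_nonneg (by positivity), Real.norm_of_nonneg (by positivity), one_mul,
    ← Real.rpow_natCast, Real.rpow_def_of_pos hn0, Real.rpow_def_of_pos hn0, one_div,
    ← Real.exp_neg, ← Real.exp_add, Real.exp_le_exp]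
  linarith

/-! ### Depth and spine statistics, and their comparison with the height -/

/-- The generating function of the depths of the nodes. -/
noncomputable def depthGen (x : ℝ) (T : NodeSet) : ℝ := ∑ v ∈ T, x ^ v.length

/-- The number of nodes on the right spine. -/
def spine (T : NodeSet) : ℕ := (T.filter (fun v => ∀ b ∈ v, b = true)).card

theorem disjoint_node_root (S T : NodeSet) :
    Disjoint ({[]} : NodeSet) (S.image (List.cons false)) ∧
    Disjoint ({[]} ∪ S.image (List.cons false) : NodeSet) (T.image (List.cons true)) := by
  constructor
  · simp
  · rw [Finset.disjoint_left]
    intro v hv hv'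
    simp only [Finset.mem_union, Finset.mem_singleton, Finset.mem_image] at hv hv'
    obtain ⟨w, _, rfl⟩ := hv'
    simp at hv

theorem depthGen_node (x : ℝ) (S T : NodeSet) :
    depthGen x (node S T) = 1 + x * depthGen x S + x * depthGen x T := by
  rw [depthGen, node, Finset.sum_union (disjoint_node_root S T).2,
    Finset.sum_union (disjoint_node_root S T).1,
    Finset.sum_image (fun _ _ _ _ h => (List.cons.inj h).2),
    Finset.sum_image (fun _ _ _ _ h => (List.cons.inj h).2), depthGen, depthGen,
    Finset.mul_sum, Finset.mul_sum]
  simp [pow_succ']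

theorem spine_node (S T : NodeSet) : spine (node S T) = spine T + 1 := by
  have h : (node S T).filter (fun v => ∀ b ∈ v, b = true) =
      insert [] ((T.filter (fun v => ∀ b ∈ v, b = true)).image (List.cons true)) := by
    ext v
    simp only [node, Finset.mem_filter, Finset.mem_union, Finset.mem_singleton, Finset.mem_image,
      Finset.mem_insert]
    constructor
    · rintro ⟨(rfl | ⟨w, _, rfl⟩) | ⟨w, hw, rfl⟩, hv⟩
      · exact Or.inl rfl
      · simp at hv
      · exact Or.inr ⟨w, ⟨hw, fun b hb => hv b (List.mem_cons_of_mem _ hb)⟩, rfl⟩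
    · rintro (rfl | ⟨w, ⟨hw, hv⟩, rfl⟩)
      · simp
      · exact ⟨Or.inr ⟨w, hw, rfl⟩, by simpa using hv⟩
  rw [spine, h, Finset.card_insert_of_notMem (by simp),
    Finset.card_image_of_injective _ (fun _ _ h => (List.cons.inj h).2), spine]

/-- The generating function of the size of the right spine. -/
noncomputable def spineGen (y : ℝ) (T : NodeSet) : ℝ := y ^ spine T

theorem spineGen_node (y : ℝ) (S T : NodeSet) :
    spineGen y (node S T) = 0 + 0 * spineGen y S + y * spineGen y T := by
  rw [spineGen, spine_node, pow_succ, spineGen, spineGen]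
  ring

theorem spineGen_nonneg {y : ℝ} (hy : 0 ≤ y) (T : NodeSet) : 0 ≤ spineGen y T := pow_nonneg hy _

/-- A node of the right spine is determined by its depth, which lies between 0 and the maximum. -/
theorem spine_le (T : NodeSet) : spine T ≤ T.sup List.length + 1 := by
  rw [spine, ← Finset.card_range (T.sup List.length + 1)]
  refine Finset.card_le_card_of_injOn List.length ?_ ?_
  · intro v hv
    simp only [Finset.coe_filter, Set.mem_ofPred_eq] at hv
    simpa [Nat.lt_succ_iff] using Finset.le_sup (f := List.length) hv.1
  · intro v hv w hw hvw
    simp only [Finset.coe_filter, Set.mem_ofPred_eq] at hv hw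
    rw [List.eq_replicate_of_mem hv.2, List.eq_replicate_of_mem hw.2, hvw]

theorem height_eq_of_root_mem {T : NodeSet} (h : [] ∈ T) : height T = T.sup List.length := by
  have : sInf (List.length '' (T : Set (List Bool))) = 0 :=
    Nat.sInf_eq_zero.2 (Or.inl ⟨[], h, rfl⟩)
  rw [height, this, Nat.sub_zero]

theorem pow_height_le_depthGen {x : ℝ} (hx : 0 ≤ x) {T : NodeSet} (h : [] ∈ T) :
    x ^ height T ≤ depthGen x T := by
  obtain ⟨v, hv, hv'⟩ := Finset.exists_mem_eq_sup T ⟨_, h⟩ List.length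
  rw [height_eq_of_root_mem h, hv']
  exact Finset.single_le_sum (f := fun v : List Bool => x ^ v.length)
    (fun _ _ => pow_nonneg hx _) hv

theorem root_mem_node (S T : NodeSet) : [] ∈ node S T := by simp [node]

/-- A convolution with a geometric sequence obeys a one-step recursion; this is what removes the
right-subtree sums when q times one instance of `treeMean_rec` is subtracted from the next. -/
theorem sum_qpow_reverse_succ (q : ℝ) (f : ℕ → ℝ) (n : ℕ) :
    ∑ k ∈ Finset.range (n + 1), q ^ k * f (n - k) =
      f n + q * ∑ k ∈ Finset.range n, q ^ k * f (n - 1 - k) := by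
  rw [Finset.sum_range_succ', add_comm, Finset.mul_sum]
  congr 1
  · simp
  · refine Finset.sum_congr rfl fun k _ => ?_
    rw [show n - (k + 1) = n - 1 - k by omega, pow_succ']
    ring

theorem one_sub_mul_qnum (q : ℝ) (n : ℕ) : (1 - q) * qnum q n = 1 - q ^ n := by
  rw [mul_comm, qnum, geom_sum_mul_neg]

theorem one_sub_mul_qnum_le {q : ℝ} (hq : 0 ≤ q) (n : ℕ) : (1 - q) * qnum q n ≤ 1 := by
  rw [one_sub_mul_qnum]
  have := pow_nonneg hq n
  linarith

/-- Complements the lower bound 1/[n] ≥ 1-q: the excess is at most 1/n, uniformly in q. -/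
theorem inv_qnum_succ_le {q : ℝ} (hq : 0 ≤ q) (hq1 : q ≤ 1) (n : ℕ) :
    1 / qnum q (n + 1) ≤ (1 - q) + 1 / ((n : ℝ) + 1) := by
  have hpos := qnum_succ_pos hq n
  -- In the induction step, (1-q)[m] = 1 - q^m and the new term q^m together supply the extra 1.
  have key : ∀ m : ℕ, (m : ℝ) ≤ qnum q m * (1 + m * (1 - q)) := by
    intro m
    induction m with
    | zero => simp [qnum]
    | succ m ih =>
      have h1 := one_sub_mul_qnum q m
      have h2 : qnum q (m + 1) = qnum q m + q ^ m := Finset.sum_range_succ _ _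
      have h3 : (m : ℝ) * (1 - q) * q ^ m ≥ 0 := by
        have := pow_nonneg hq m
        have : 0 ≤ 1 - q := by linarith
        positivity
      have h4 : 0 ≤ (1 - q) * q ^ m := mul_nonneg (by linarith) (pow_nonneg hq m)
      rw [h2]
      push_cast
      nlinarith
  have := key (n + 1)
  push_cast at this
  rw [div_le_iff₀ hpos]
  have h5 : ((1 - q) + 1 / ((n : ℝ) + 1)) * qnum q (n + 1) =
      qnum q (n + 1) * (1 + (n + 1) * (1 - q)) / (n + 1) := by
    field_simp
    ring
  rw [h5, le_div_iff₀ (by positivity)]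
  linarith

/-! ### Exponential bound for the spine mean -/

section Spine

variable {q y : ℝ}

theorem spineMean_succ (hq : 0 ≤ q) (n : ℕ) :
    treeMean q (spineGen y) (n + 2) * qnum q (n + 2) =
      treeMean q (spineGen y) (n + 1) * (qnum q (n + 2) - (1 - y)) := by
  have h1 := treeMean_rec hq (spineGen_node y) (n + 1)
  have h2 := treeMean_rec hq (spineGen_node y) (n + 2)
  rw [show n + 2 - 1 = n + 1 from rfl, sum_qpow_reverse_succ] at h2
  have h3 := qnum_succ q (n + 1)
  rw [show n + 1 + 1 = n + 2 from rfl] at h3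
  linear_combination h2 - q * h1 - treeMean q (spineGen y) (n + 1) * h3

theorem spineMean_le (hq : 0 ≤ q) (hy : 0 < y) (hy1 : y < 1) (n : ℕ) :
    treeMean q (spineGen y) (n + 1) ≤ Real.exp (-((1 - y) * (((n : ℝ) + 1) * (1 - q)))) := by
  have hpos : ∀ n, 0 ≤ treeMean q (spineGen y) n := by
    intro n
    rw [treeMean, ← wmean_const hq (Finset.range n) 0]
    exact wmean_mono hq _ fun l _ => spineGen_nonneg hy.le _
  induction n with
  | zero =>
    have h := treeMean_rec hq (spineGen_node y) 1
    have h0 : treeMean q (spineGen y) 0 = 1 := by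
      rw [treeMean_zero]; simp [spineGen, spine]
    simp [qnum, h0] at h
    simp only [zero_add, h, Nat.cast_zero]
    have h1 := Real.add_one_le_exp (-((1 - y) * (1 * (1 - q))))
    have h2 : 0 ≤ (1 - y) * q := mul_nonneg (by linarith) hq
    nlinarith
  | succ n ih =>
    have hQ := qnum_succ_pos hq (n + 1)
    have hQ1 := one_sub_mul_qnum_le hq (n + 2)
    have h := spineMean_succ (y := y) hq n
    have h1 : treeMean q (spineGen y) (n + 2) ≤
        treeMean q (spineGen y) (n + 1) * Real.exp (-((1 - y) * (1 - q))) := by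
      have h2 := Real.add_one_le_exp (-((1 - y) * (1 - q)))
      have h3 := mul_le_mul_of_nonneg_left h2 (hpos (n + 1))
      refine le_trans ?_ h3
      rw [← mul_le_mul_iff_left₀ hQ, show n + 1 + 1 = n + 2 from rfl, h, mul_assoc]
      refine mul_le_mul_of_nonneg_left ?_ (hpos _)
      have h4 := mul_le_mul_of_nonneg_left hQ1 (show 0 ≤ 1 - y by linarith)
      linarith
    refine h1.trans ((mul_le_mul_of_nonneg_right ih (Real.exp_pos _).le).trans ?_)
    rw [← Real.exp_add]
    refine Real.exp_le_exp.2 (le_of_eq ?_)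
    push_cast
    ring

end Spine

/-! ### Growth of the mean depth generating function -/

section DepthGen

variable {q x : ℝ}

theorem treeMean_depthGen_nonneg (hq : 0 ≤ q) (hx : 1 < x) (n : ℕ) :
    0 ≤ treeMean q (depthGen x) n := by
  rw [treeMean, ← wmean_const hq (Finset.range n) 0]
  exact wmean_mono hq _ fun l _ => Finset.sum_nonneg fun _ _ => by positivity

theorem treeMean_depthGen_succ (hq : 0 ≤ q) (n : ℕ) :
    treeMean q (depthGen x) (n + 1) * qnum q (n + 1) =
      treeMean q (depthGen x) n * (qnum q (n + 1) + (x - 1) + x * q ^ n) + 1 +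
        x * ((1 - q) * ∑ k ∈ Finset.range n, q ^ k * treeMean q (depthGen x) k) := by
  have h1 := treeMean_rec hq (depthGen_node x) n
  have h2 := treeMean_rec hq (depthGen_node x) (n + 1)
  rw [Nat.add_sub_cancel, sum_qpow_reverse_succ, Finset.sum_range_succ] at h2
  have h3 := qnum_succ q n
  linear_combination h2 - q * h1 + (1 - treeMean q (depthGen x) n) * h3

theorem treeMean_depthGen_one (hq : 0 ≤ q) : treeMean q (depthGen x) 1 = 1 := by
  have h := treeMean_depthGen_succ (x := x) hq 0
  have h0 : treeMean q (depthGen x) 0 = 0 := by rw [treeMean_zero]; simp [depthGen]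
  simpa [qnum, h0] using h

theorem sum_depthGen_nonneg (hq : 0 ≤ q) (hx : 1 < x) (n : ℕ) :
    0 ≤ ∑ k ∈ Finset.range n, q ^ k * treeMean q (depthGen x) k :=
  Finset.sum_nonneg fun k _ => mul_nonneg (pow_nonneg hq k) (treeMean_depthGen_nonneg hq hx k)

/-- Only the term x-1 of the recursion is kept, together with 1 ≥ (1-q)[n+1]. This crude lower bound
is what later makes the error terms small relative to the mean. -/
theorem treeMean_depthGen_growth (hq : 0 ≤ q) (hq1 : q ≤ 1) (hx : 1 < x) (n : ℕ) :
    (1 + (x - 1) * (1 - q)) * treeMean q (depthGen x) n ≤ treeMean q (depthGen x) (n + 1) := by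
  have hQ := qnum_succ_pos hq n
  rw [← mul_le_mul_iff_left₀ hQ, treeMean_depthGen_succ hq]
  have hf := treeMean_depthGen_nonneg hq hx n
  have h1 := mul_le_mul_of_nonneg_left (one_sub_mul_qnum_le hq (n + 1))
    (mul_nonneg (show 0 ≤ x - 1 by linarith) hf)
  have h2 : 0 ≤ treeMean q (depthGen x) n * (x * q ^ n) :=
    mul_nonneg hf (mul_nonneg (by linarith) (pow_nonneg hq n))
  have h3 : 0 ≤ x * ((1 - q) * ∑ k ∈ Finset.range n, q ^ k * treeMean q (depthGen x) k) :=
    mul_nonneg (by linarith) (mul_nonneg (by linarith) (sum_depthGen_nonneg hq hx n))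
  linarith

theorem pow_le_treeMean_depthGen (hq : 0 ≤ q) (hq1 : q ≤ 1) (hx : 1 < x) (n : ℕ) :
    (1 + (x - 1) * (1 - q)) ^ n ≤ treeMean q (depthGen x) (n + 1) := by
  have hr : 0 ≤ 1 + (x - 1) * (1 - q) := by
    have := mul_nonneg (show 0 ≤ x - 1 by linarith) (show 0 ≤ 1 - q by linarith)
    linarith
  induction n with
  | zero => rw [treeMean_depthGen_one hq, pow_zero]
  | succ n ih =>
    rw [pow_succ']
    exact (mul_le_mul_of_nonneg_left ih hr).trans (treeMean_depthGen_growth hq hq1 hx (n + 1))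

/-- The left subtrees contribute little. -/
theorem sum_depthGen_le (hq : 0 ≤ q) (hq1 : q ≤ 1) (hx : 1 < x) (hx' : x ≤ 3 / 2) (n : ℕ) :
    (1 - q) * (∑ k ∈ Finset.range n, q ^ k * treeMean q (depthGen x) k) *
      (1 + (x - 1) * (1 - q)) ^ n ≤ 2 * treeMean q (depthGen x) n := by
  set f := treeMean q (depthGen x) with hf
  set r := 1 + (x - 1) * (1 - q) with hr
  have hr1 : 1 ≤ r := by
    have := mul_nonneg (show 0 ≤ x - 1 by linarith) (show 0 ≤ 1 - q by linarith)
    linarith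
  have hqr : 1 - q * r = (1 - q) * (1 - q * (x - 1)) := by rw [hr]; ring
  have hqx : q * (x - 1) ≤ 1 / 2 := by nlinarith
  have hqr0 : 0 ≤ q * r := mul_nonneg hq (by linarith)
  have hqr1 : q * r ≤ 1 := by
    have := mul_nonneg (show 0 ≤ 1 - q by linarith) (show 0 ≤ 1 - q * (x - 1) by linarith)
    linarith
  -- Growth gives f(k) ≤ r^(k-n) f(n), so the sum is at most f(n) r^(-n) times a geometric sum of
  -- ratio qr. Multiplying through by 1-qr keeps the case q = 1 valid; then 1-qr ≥ (1-q)/2 gives the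
  -- factor 2.
  have key : ∀ n, (1 - q * r) * (∑ k ∈ Finset.range n, q ^ k * f k) * r ^ n ≤
      f n * (1 - (q * r) ^ n) := by
    intro n
    induction n with
    | zero => simp
    | succ n ih =>
      rw [Finset.sum_range_succ]
      have h1 := mul_le_mul_of_nonneg_left ih (show 0 ≤ r by linarith)
      have h2 : (1 - q * r) * (∑ k ∈ Finset.range n, q ^ k * f k + q ^ n * f n) * r ^ (n + 1) =
          r * ((1 - q * r) * (∑ k ∈ Finset.range n, q ^ k * f k) * r ^ n) +
            r * ((1 - q * r) * (q * r) ^ n * f n) := by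
        rw [mul_pow]; ring
      have h3 : 0 ≤ 1 - (q * r) ^ (n + 1) := by
        have := pow_le_one₀ hqr0 hqr1 (n := n + 1)
        linarith
      have h4 := mul_le_mul_of_nonneg_right (treeMean_depthGen_growth hq hq1 hx n) h3
      rw [← hf, ← hr] at h4
      rw [h2]
      refine le_trans (add_le_add h1 le_rfl) (le_trans (le_of_eq ?_) h4)
      ring
  have h1 := key n
  have h2 : f n * (1 - (q * r) ^ n) ≤ f n := by
    have := mul_nonneg (treeMean_depthGen_nonneg hq hx n) (pow_nonneg hqr0 n)
    rw [← hf] at this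
    linarith
  have h3 : 0 ≤ (1 - q) * (∑ k ∈ Finset.range n, q ^ k * f k) * r ^ n :=
    mul_nonneg (mul_nonneg (by linarith) (sum_depthGen_nonneg hq hx n))
      (pow_nonneg (by linarith) n)
  have h4 : (1 - q * r) * (∑ k ∈ Finset.range n, q ^ k * f k) * r ^ n =
      (1 - q * (x - 1)) * ((1 - q) * (∑ k ∈ Finset.range n, q ^ k * f k) * r ^ n) := by
    rw [hqr]; ring
  rw [h4] at h1
  nlinarith

/-- Three terms of the recursion are errors: x q^(n+1), the constant 1 and the left-subtree sum.
Relative to the mean they are at most 3/2, 2 and 3 times r^(-(n+1)), hence the constant 7. -/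
theorem treeMean_depthGen_step (hq : 0 ≤ q) (hq1 : q ≤ 1) (hx : 1 < x) (hx' : x ≤ 3 / 2) (n : ℕ) :
    treeMean q (depthGen x) (n + 2) ≤ treeMean q (depthGen x) (n + 1) *
      (1 + ((x - 1) + 7 * ((1 + (x - 1) * (1 - q)) ^ (n + 1))⁻¹) / qnum q (n + 2)) := by
  have hQ := qnum_succ_pos hq (n + 1)
  rw [← mul_le_mul_iff_left₀ hQ, treeMean_depthGen_succ hq, show n + 1 + 1 = n + 2 from rfl]
  have hL := sum_depthGen_le hq hq1 hx hx' (n + 1)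
  have hG := pow_le_treeMean_depthGen hq hq1 hx n
  have hf := treeMean_depthGen_nonneg hq hx (n + 1)
  set f := treeMean q (depthGen x) (n + 1)
  set S := (1 - q) * ∑ k ∈ Finset.range (n + 1), q ^ k * treeMean q (depthGen x) k
  set r := 1 + (x - 1) * (1 - q) with hr
  have h0 := mul_nonneg (show 0 ≤ x - 1 by linarith) (show 0 ≤ 1 - q by linarith)
  have hr1 : 1 ≤ r := by linarith
  have hr2 : r ≤ 2 := by nlinarith
  have hqr : q * r ≤ 1 := by nlinarith
  have hrn : 0 < r ^ (n + 1) := by positivity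
  have hA : q ^ (n + 1) ≤ (r ^ (n + 1))⁻¹ := by
    rw [← one_div, le_div_iff₀ hrn, ← mul_pow]
    exact pow_le_one₀ (mul_nonneg hq (by linarith)) hqr
  have hB : S ≤ 2 * f * (r ^ (n + 1))⁻¹ := by
    rw [← div_eq_mul_inv, le_div_iff₀ hrn]
    exact hL
  -- The mean is at least r^n, and the missing factor r is at most 2.
  have hC : 1 ≤ 2 * f * (r ^ (n + 1))⁻¹ := by
    rw [← div_eq_mul_inv, le_div_iff₀ hrn, one_mul, pow_succ']
    have : 0 ≤ r ^ n := by positivity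
    nlinarith
  rw [mul_assoc, add_mul, div_mul_cancel₀ _ hQ.ne', one_mul]
  set ρ := (r ^ (n + 1))⁻¹
  have hρ : 0 ≤ f * ρ := by
    have : 0 ≤ ρ := by positivity
    positivity
  have h1 : f * (x * q ^ (n + 1)) ≤ 3 / 2 * (f * ρ) := by
    have := mul_le_mul_of_nonneg_left hA (mul_nonneg hf (show 0 ≤ x by linarith))
    nlinarith
  have h2 : x * S ≤ 3 * (f * ρ) := by
    have := mul_le_mul_of_nonneg_left hB (show 0 ≤ x by linarith)
    nlinarith
  nlinarith

theorem treeMean_depthGen_le (hq : 0 ≤ q) (hq1 : q ≤ 1) (hx : 1 < x) (hx' : x ≤ 3 / 2) (n : ℕ) :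
    treeMean q (depthGen x) (n + 1) ≤ ((n : ℝ) + 1) ^ 8 *
      Real.exp ((x - 1) * (((n : ℝ) + 1) * (1 - q)) + 14 / (x - 1)) := by
  set r := 1 + (x - 1) * (1 - q) with hr
  have h0 := mul_nonneg (show 0 ≤ x - 1 by linarith) (show 0 ≤ 1 - q by linarith)
  have hr1 : 1 ≤ r := by linarith
  have key : ∀ n : ℕ, treeMean q (depthGen x) (n + 1) ≤ ((n : ℝ) + 1) ^ 8 *
      Real.exp ((x - 1) * (((n : ℝ) + 1) * (1 - q)) +
        7 * ((1 - q) * ∑ j ∈ Finset.range (n + 1), (r ^ j)⁻¹)) := by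
    intro n
    induction n with
    | zero =>
      have h1 : (1 : ℝ) ≤ Real.exp ((x - 1) * (1 - q) + 7 * (1 - q)) :=
        Real.one_le_exp (by linarith)
      simpa [treeMean_depthGen_one hq] using h1
    | succ n ih =>
      refine (treeMean_depthGen_step hq hq1 hx hx' n).trans ?_
      rw [← hr]
      set ρ := (r ^ (n + 1))⁻¹ with hρ
      have hρ0 : 0 ≤ ρ := by positivity
      have hρ1 : ρ ≤ 1 := inv_le_one_of_one_le₀ (one_le_pow₀ hr1)
      have hQ := inv_qnum_succ_le hq hq1 (n + 1)
      -- The part 1-q of the bound on 1/[n+2] goes into the exponential. The remaining 1/(n+2) has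
      -- coefficient at most 1/2 + 7 ≤ 8, which produces the eighth power.
      have hstep : 1 + ((x - 1) + 7 * ρ) / qnum q (n + 2) ≤
          Real.exp ((x - 1) * (1 - q) + 7 * ((1 - q) * ρ)) *
            (((n : ℝ) + 1 + 1) / (n + 1)) ^ 8 := by
        have h1 : ((x - 1) + 7 * ρ) / qnum q (n + 2) ≤
            ((x - 1) * (1 - q) + 7 * ((1 - q) * ρ)) + 8 * (1 / (((n + 1 : ℕ) : ℝ) + 1)) := by
          have h2 := mul_le_mul_of_nonneg_left hQ (show 0 ≤ (x - 1) + 7 * ρ by linarith)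
          have h3 : (0 : ℝ) ≤ 1 / (((n + 1 : ℕ) : ℝ) + 1) := by positivity
          have h4 := mul_le_mul_of_nonneg_right (show (x - 1) + 7 * ρ ≤ 8 by linarith) h3
          rw [mul_one_div] at h2
          linarith
        have h2 := Real.add_one_le_exp
          (((x - 1) * (1 - q) + 7 * ((1 - q) * ρ)) + 8 * (1 / (((n + 1 : ℕ) : ℝ) + 1)))
        rw [Real.exp_add] at h2
        have h3 := exp_inv_succ_le (n := n + 1) (by omega)
        have h4 := pow_le_pow_left₀ (Real.exp_pos _).le h3 8
        rw [← Real.exp_nat_mul] at h4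
        push_cast at h4 h2 h1
        have h5 := mul_le_mul_of_nonneg_left h4
          (Real.exp_pos ((x - 1) * (1 - q) + 7 * ((1 - q) * ρ))).le
        linarith
      have hpos : (0 : ℝ) ≤ 1 + ((x - 1) + 7 * ρ) / qnum q (n + 2) := by
        have := (qnum_succ_pos hq (n + 1)).le
        have := div_nonneg (show 0 ≤ (x - 1) + 7 * ρ by linarith) this
        linarith
      refine (mul_le_mul ih hstep hpos (by positivity)).trans (le_of_eq ?_)
      rw [Finset.sum_range_succ _ (n + 1), ← hρ]
      have h6 : (x - 1) * ((((n + 1 : ℕ) : ℝ) + 1) * (1 - q)) +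
          7 * ((1 - q) * (∑ j ∈ Finset.range (n + 1), (r ^ j)⁻¹ + ρ)) =
          ((x - 1) * (((n : ℝ) + 1) * (1 - q)) +
            7 * ((1 - q) * ∑ j ∈ Finset.range (n + 1), (r ^ j)⁻¹)) +
          ((x - 1) * (1 - q) + 7 * ((1 - q) * ρ)) := by
        push_cast; ring
      rw [h6]
      generalize (x - 1) * (((n : ℝ) + 1) * (1 - q)) +
        7 * ((1 - q) * ∑ j ∈ Finset.range (n + 1), (r ^ j)⁻¹) = a
      generalize (x - 1) * (1 - q) + 7 * ((1 - q) * ρ) = b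
      rw [Real.exp_add, div_pow]
      push_cast
      field_simp
  refine (key n).trans (mul_le_mul_of_nonneg_left (Real.exp_le_exp.2 ?_) (by positivity))
  have h1 := geom_decay_sum r hr1 (n + 1)
  -- Since r-1 = (x-1)(1-q), the factor 1-q cancels the length of the geometric sum, giving a bound
  -- uniform in q and n.
  have h2 : (1 - q) * ∑ j ∈ Finset.range (n + 1), (r ^ j)⁻¹ ≤ 2 / (x - 1) := by
    rw [le_div_iff₀ (by linarith)]
    have : r - 1 = (x - 1) * (1 - q) := by rw [hr]; ring
    rw [this] at h1
    have hr2 : r ≤ 2 := by nlinarith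
    linarith
  have h3 : 14 / (x - 1) = 7 * (2 / (x - 1)) := by ring
  rw [h3]
  linarith

end DepthGen

/-! ### From random permutations to words, and Markov's inequality -/

theorem wordInv_ofFn {α : Type} [LinearOrder α] {n : ℕ} (f : Fin n → α) :
    wordInv (List.ofFn f) =
      (Finset.univ.filter (fun p : Fin n × Fin n => p.1 < p.2 ∧ f p.2 < f p.1)).card := by
  induction n with
  | zero => simp [wordInv]
  | succ n ih =>
    rw [List.ofFn_succ, wordInv, ih, Finset.card_filter, Finset.card_filter,
      Fintype.sum_prod_type, Fintype.sum_prod_type, Fin.sum_univ_succ]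
    congr 1
    · rw [Fin.sum_univ_succ]
      simp only [lt_irrefl, false_and, if_false, zero_add, Fin.succ_pos, true_and]
      rw [← Finset.card_filter, List.ofFn_eq_map, List.countP_map,
        List.countP_eq_length_filter]
      rfl
    · refine Finset.sum_congr rfl fun i _ => ?_
      rw [Fin.sum_univ_succ]
      simp

theorem sum_perm_eq_wsum (q : ℝ) (n : ℕ) (F : List (Fin n) → ℝ) :
    ∑ σ : Equiv.Perm (Fin n), q ^ inv σ * F (List.ofFn σ) = wsum q Finset.univ F := by
  rw [wsum]
  refine Finset.sum_bij (fun σ _ => List.ofFn σ) ?_ ?_ ?_ ?_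
  · intro σ _
    rw [mem_arrangements]
    refine (Multiset.Nodup.ext Finset.univ.nodup ?_).2 ?_
    · rw [Multiset.coe_nodup]
      exact List.nodup_ofFn.2 σ.injective
    · intro a
      exact ⟨fun _ => Multiset.mem_coe.2 (List.mem_ofFn.2 (σ.surjective a)),
        fun _ => Finset.mem_univ a⟩
  · intro σ _ τ _ h
    exact Equiv.coe_fn_injective (List.ofFn_injective h)
  · intro l hl
    rw [mem_arrangements] at hl
    have hlen : l.length = n := by
      have := congrArg Multiset.card hl
      simpa using this.symm
    have hnd : l.Nodup := by
      rw [← Multiset.coe_nodup, ← hl]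
      exact Finset.univ.nodup
    have hinj : Function.Injective (fun i : Fin n => l.get (Fin.cast hlen.symm i)) :=
      (List.nodup_iff_injective_get.1 hnd).comp (Fin.cast_injective _)
    refine ⟨Equiv.ofBijective _ (Finite.injective_iff_bijective.1 hinj), Finset.mem_univ _, ?_⟩
    refine List.ext_get (by simp [hlen]) fun i _ _ => ?_
    simp
  · intro σ _
    rw [wordInv_ofFn, inv]

theorem qfact_eq_sum_perm {q : ℝ} (hq : 0 ≤ q) (n : ℕ) :
    ∑ σ : Equiv.Perm (Fin n), q ^ inv σ = qfact q n := by
  have h1 := sum_perm_eq_wsum q n (fun _ => 1)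
  have h2 := wmean_const hq (Finset.univ : Finset (Fin n)) 1
  rw [wmean, div_eq_one_iff_eq (qfact_pos hq _).ne', Finset.card_fin] at h2
  simpa [h2] using h1

theorem mallows_apply_toReal (n : ℕ) (q : ℝ≥0) (σ : Equiv.Perm (Fin n)) :
    (mallows n q σ).toReal = (q : ℝ) ^ inv σ / qfact q n := by
  rw [mallows, PMF.normalize_apply, ENNReal.toReal_mul, ENNReal.toReal_inv, tsum_fintype,
    ENNReal.toReal_sum (fun _ _ => ENNReal.pow_ne_top ENNReal.coe_ne_top), div_eq_mul_inv,
    ← qfact_eq_sum_perm q.coe_nonneg]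
  simp

/-- A Markov bound for the Mallows tree. -/
theorem mallowsTree_real_le (n : ℕ) (q : ℝ≥0) (A : Set NodeSet) (φ ψ : NodeSet → ℝ)
    (a b : ℝ) (h : ∀ T : NodeSet, 0 ≤ a * φ T + b * ψ T)
    (hA : ∀ T ∈ A, [] ∈ T → 1 ≤ a * φ T + b * ψ T) (hn : n ≠ 0) :
    (mallowsTree n q).toMeasure.real A ≤
      a * wmean q (Finset.univ : Finset (Fin n)) (fun l => φ (bst l)) +
        b * wmean q (Finset.univ : Finset (Fin n)) (fun l => ψ (bst l)) := by
  classical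
  have hreal : (mallowsTree n q).toMeasure.real A =
      wmean q (Finset.univ : Finset (Fin n)) (fun l => A.indicator 1 (bst l)) := by
    rw [Measure.real, mallowsTree, PMF.toMeasure_apply_eq_toOuterMeasure,
      PMF.toOuterMeasure_map_apply, PMF.toOuterMeasure_apply_fintype,
      ENNReal.toReal_sum, wmean, ← sum_perm_eq_wsum, Finset.sum_div, Finset.card_fin]
    · refine Finset.sum_congr rfl fun σ _ => ?_
      by_cases hσ : bst (List.ofFn σ) ∈ A
      · rw [Set.indicator_of_mem (by exact hσ), Set.indicator_of_mem hσ, mallows_apply_toReal]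
        simp
      · rw [Set.indicator_of_notMem (by exact hσ), Set.indicator_of_notMem hσ]
        simp
    · intro σ _
      refine ne_top_of_le_ne_top ((mallows n q).apply_ne_top σ) (Set.indicator_le_self _ _ _)
  rw [hreal, ← wmean_mul, ← wmean_mul, ← wmean_add]
  refine wmean_mono q.coe_nonneg _ fun l hl => ?_
  by_cases hT : bst l ∈ A
  · rw [Set.indicator_of_mem hT, Pi.one_apply]
    refine hA _ hT ?_
    cases l with
    | nil =>
      exfalso
      have := congrArg Multiset.card hl
      simp at this
      exact hn this.symm
    | cons a l => rw [bst_cons]; exact root_mem_node _ _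
  · rw [Set.indicator_of_notMem hT]
    exact h _

end MallowsTree

/-! ### Assembling the two tails -/

open MallowsTree in
theorem theorem2 (q : ℕ → ℝ≥0) (hq : ∀ n, q n ≤ 1)
    (hlim : Tendsto (fun n : ℕ => (n : ℝ) * (1 - (q n : ℝ)) / Real.log n) atTop atTop)
    (ε : ℝ) (hε : 0 < ε) (lam : ℝ) (hlam : 0 < lam) :
    (fun n : ℕ => (MallowsTree.mallowsTree n (q n)).toMeasure.real
        {T : MallowsTree.NodeSet |
          ε < |(MallowsTree.height T : ℝ) / ((n : ℝ) * (1 - (q n : ℝ))) - 1|})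
      =O[atTop] (fun n : ℕ => 1 / (n : ℝ) ^ lam) := by
  obtain ⟨x, hx1, hx2, hx⟩ := exists_upper_rate hε
  obtain ⟨y, hy0, hy1, hy⟩ := exists_lower_rate hε
  set m : ℕ → ℝ := fun n => (n : ℝ) * (1 - (q n : ℝ)) with hm
  have hupper := (pow_mul_exp_isBigO hlim hx 8 lam).const_mul_left (Real.exp (14 / (x - 1)))
  have hlower := (pow_mul_exp_isBigO hlim hy 0 lam).const_mul_left y⁻¹
  refine IsBigO.trans (IsBigO.of_bound 1 ?_) (hupper.add hlower)
  filter_upwards [hlim.eventually_gt_atTop 0, eventually_ge_atTop 2] with n hn hn2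
  have hn2' : (2 : ℝ) ≤ n := by exact_mod_cast hn2
  -- Positivity of the normalisation excludes q_n = 1 here, where the quotient would take the
  -- default value 0.
  have hmpos : 0 < m n := (div_pos_iff_of_pos_right (Real.log_pos (by linarith))).1 hn
  have hx0 : 0 < x := by linarith
  have hq1 : (q n : ℝ) ≤ 1 := by exact_mod_cast hq n
  rw [one_mul, Real.norm_of_nonneg measureReal_nonneg]
  refine le_trans ?_ (le_abs_self _)
  have hgen : ∀ T, 0 ≤ depthGen x T := fun T => Finset.sum_nonneg fun _ _ => by positivity
  -- One Markov bound treats both tails: each deviation makes one of the two nonnegative terms at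
  -- least 1. The +1 in the exponent of y accounts for a spine having one more node than its depth.
  refine (mallowsTree_real_le n (q n) _ (depthGen x) (spineGen y)
    (x ^ ((1 + ε) * m n))⁻¹ (y ^ ((1 - ε) * m n + 1))⁻¹ (fun T => ?_) (fun T hT hroot => ?_)
    (by omega)).trans ?_
  · have h1 := hgen T
    have h2 := spineGen_nonneg hy0.le T
    positivity
  · have hcase : (1 + ε) * m n < height T ∨ (height T : ℝ) < (1 - ε) * m n := by
      rw [Set.mem_ofPred_eq, lt_abs] at hT
      rcases hT with hT | hT
      · left
        rw [← lt_div_iff₀ hmpos]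
        linarith
      · right
        rw [← div_lt_iff₀ hmpos]
        linarith
    have hA : 0 ≤ (x ^ ((1 + ε) * m n))⁻¹ * depthGen x T := mul_nonneg (by positivity) (hgen T)
    have hB : 0 ≤ (y ^ ((1 - ε) * m n + 1))⁻¹ * spineGen y T :=
      mul_nonneg (by positivity) (spineGen_nonneg hy0.le T)
    rcases hcase with h | h
    · have h1 : x ^ ((1 + ε) * m n) ≤ depthGen x T := by
        refine le_trans ?_ (pow_height_le_depthGen hx0.le hroot)
        rw [← Real.rpow_natCast]
        exact Real.rpow_le_rpow_of_exponent_le hx1.le h.le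
      have h2 : 1 ≤ (x ^ ((1 + ε) * m n))⁻¹ * depthGen x T := by
        rw [inv_mul_eq_div, one_le_div (by positivity)]
        exact h1
      linarith
    · have h1 : y ^ ((1 - ε) * m n + 1) ≤ spineGen y T := by
        rw [spineGen]
        rw [← Real.rpow_natCast]
        refine Real.rpow_le_rpow_of_exponent_ge hy0 hy1.le ?_
        have h3 : (spine T : ℝ) ≤ height T + 1 := by
          rw [height_eq_of_root_mem hroot]
          exact_mod_cast spine_le T
        linarith
      have h2 : 1 ≤ (y ^ ((1 - ε) * m n + 1))⁻¹ * spineGen y T := by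
        rw [inv_mul_eq_div, one_le_div (by positivity)]
        exact h1
      linarith
  · rw [wmean_bst (q n).coe_nonneg (depthGen_node x) n _ (Finset.card_fin n),
      wmean_bst (q n).coe_nonneg (spineGen_node y) n _ (Finset.card_fin n)]
    obtain ⟨k, rfl⟩ : ∃ k, n = k + 1 := ⟨n - 1, by omega⟩
    have h1 := treeMean_depthGen_le (q (k + 1)).coe_nonneg hq1 hx1 hx2 k
    have h2 := spineMean_le (q (k + 1)).coe_nonneg hy0 hy1 k
    have hmk : ((k : ℝ) + 1) * (1 - (q (k + 1) : ℝ)) = m (k + 1) := by simp [hm]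
    rw [hmk] at h1 h2
    refine add_le_add
      ((mul_le_mul_of_nonneg_left h1 (by positivity)).trans (le_of_eq ?_))
      ((mul_le_mul_of_nonneg_left h2 (by positivity)).trans (le_of_eq ?_))
    · rw [Real.rpow_def_of_pos hx0, ← Real.exp_neg]
      rw [mul_left_comm, ← Real.exp_add, mul_left_comm (Real.exp (14 / (x - 1))), ← Real.exp_add]
      push_cast
      congr 2
      rw [← hmk]
      ring
    · rw [Real.rpow_add hy0, Real.rpow_one, Real.rpow_def_of_pos hy0, mul_inv, ← Real.exp_neg,
        pow_zero, one_mul, mul_comm _ y⁻¹, mul_assoc, ← Real.exp_add]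
      congr 2
      ring
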